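/- Let $\mathbb{K}$ be a field of characteristic $0$ and let $\mathfrak{g}=\bigoplus_{p\in\mathbb{Z}}\mathfrak{g}_p$ be a finite-dimensional $\mathbb{Z}$-graded Lie algebra over $\mathbb{K}$ (so $[\mathfrak{g}_p,\mathfrak{g}_q]\subseteq\mathfrak{g}_{p+q}$). Put $\mathfrak{m}=\bigoplus_{p<0}\mathfrak{g}_p$ and $\mathfrak{g}_+=\bigoplus_{p\ge 0}\mathfrak{g}_p$, and let $\mathfrak{n}$ be the maximal nilpotent ideal of $\mathfrak{g}$. Assume that (a) $\mathfrak{g}$ is effective, i.e. $\{X\in\mathfrak{g}_+ : [X,\mathfrak{g}_{-1}]=\{0\}\}=\{0\}$; (b) $\mathfrak{m}$ is fundamental, i.e. $\mathfrak{m}$ is generated by $\mathfrak{g}_{-1}$ as a Lie algebra; (c) the representation $\rho_{-1}$ of the Lie algebra $\mathfrak{g}_0$ on $\mathfrak{g}_{-1}$, obtained by restricting the adjoint representation, is irreducible (in particular $\mathfrak{g}_{-1}\neq\{0\}$). Then either $\mathfrak{g}$ is semisimple, or $\mathfrak{n}=\mathfrak{m}$ and $\mathfrak{g}=\mathfrak{m}\oplus\mathfrak{g}_0$.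 -/

import Mathlib

namespace ZGradedLie

section

variable {K : Type*} {L : Type*} [Field K] [LieRing L] [LieAlgebra K L]
variable (𝒢 : ℤ → Submodule K L)

/-- The part `𝔪 = ∑_{p < 0} 𝔤_p` of negative degree. -/
def negPart : Submodule K L := ⨆ p : {p : ℤ // p < 0}, 𝒢 p

/-- The part `𝔤₊ = ∑_{p ≥ 0} 𝔤_p` of nonnegative degree. -/
def nonnegPart : Submodule K L := ⨆ p : {p : ℤ // 0 ≤ p}, 𝒢 p

/-- The grading is effective if no nonzero element of `𝔤₊` annihilates `𝔤₋₁`: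
`{X ∈ 𝔤₊ | [X, 𝔤₋₁] = {0}} = {0}`. -/
def IsEffective : Prop :=
  ∀ X ∈ nonnegPart 𝒢, (∀ Y ∈ 𝒢 (-1), ⁅X, Y⁆ = 0) → X = 0

/-- `𝔪` is fundamental if it is generated, as a Lie algebra, by `𝔤₋₁`. -/
def IsFundamental : Prop :=
  (LieSubalgebra.lieSpan K L (𝒢 (-1) : Set L)).toSubmodule = negPart 𝒢

/-- The structure subalgebra `𝔤₀`. -/
def structureSubalgebra [SetLike.GradedBracket 𝒢] : LieSubalgebra K L where
  __ := 𝒢 0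
  lie_mem' hx hy := by
    simpa using SetLike.GradedBracket.bracket_mem (ℒ := 𝒢) hx hy

/-- The adjoint action of `𝔤₀` on the homogeneous subspace `𝔤_p`. -/
instance instLieRingModule [SetLike.GradedBracket 𝒢] (p : ℤ) :
    LieRingModule (structureSubalgebra 𝒢) (𝒢 p) where
  bracket x v := ⟨⁅(x : L), (v : L)⁆, by
    simpa using SetLike.GradedBracket.bracket_mem (ℒ := 𝒢) (i := 0) x.2 v.2⟩
  add_lie _ _ _ := Subtype.ext (add_lie _ _ _)
  lie_add _ _ _ := Subtype.ext (lie_add _ _ _)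
  leibniz_lie _ _ _ := Subtype.ext (leibniz_lie _ _ _)

instance instLieModule [SetLike.GradedBracket 𝒢] (p : ℤ) :
    LieModule K (structureSubalgebra 𝒢) (𝒢 p) where
  smul_lie _ _ _ := Subtype.ext (smul_lie _ _ _)
  lie_smul _ _ _ := Subtype.ext (lie_smul _ _ _)

/-- The representation `ρ_p` of `𝔤₀` on `𝔤_p` is irreducible (in particular `𝔤_p ≠ 0`). -/
def IsIrreducibleRep [SetLike.GradedBracket 𝒢] (p : ℤ) : Prop :=
  LieModule.IsIrreducible K (structureSubalgebra 𝒢) (𝒢 p)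

end

section

variable (K : Type*) (L : Type*) [Field K] [LieRing L] [LieAlgebra K L]

/-- The nilradical: the sum of all ideals that are nilpotent as Lie algebras, which for a
finite-dimensional Lie algebra is its maximal nilpotent ideal. (Mathlib's
`LieAlgebra.maxNilpotentIdeal` is different: it asks for ideals on which the whole Lie algebra
acts nilpotently.) -/
def nilradical : LieIdeal K L :=
  sSup {I : LieIdeal K L | LieRing.IsNilpotent I}

end

end ZGradedLie

namespace ZGradedLie

section General

variable {K L : Type*} [Field K] [LieRing L] [LieAlgebra K L]

/-- An endomorphism of a nonzero space which is diagonalizable with negative integer eigenvalues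
has nonzero trace. -/
lemma trace_ne_zero_of_iSup_eigenspace_eq_top {V : Type*} [AddCommGroup V] [Module K V] [CharZero K]
    [FiniteDimensional K V] [Nontrivial V] (f : Module.End K V)
    (h : ⨆ p : {p : ℤ // p < 0}, f.eigenspace ((p : ℤ) : K) = ⊤) :
    LinearMap.trace K V f ≠ 0 := by
  classical
  set N : {p : ℤ // p < 0} → Submodule K V := fun p ↦ f.eigenspace ((p : ℤ) : K)
  have hind : iSupIndep N :=
    f.eigenspaces_iSupIndep.comp (Int.cast_injective.comp Subtype.val_injective)
  have hint : DirectSum.IsInternal N :=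
    DirectSum.isInternal_submodule_of_iSupIndep_of_iSup_eq_top hind h
  have hfin : {p | N p ≠ ⊥}.Finite := WellFoundedGT.finite_ne_bot_of_iSupIndep hind
  have hmaps : ∀ p, Set.MapsTo f (N p) (N p) := fun p x hx ↦ by
    rw [SetLike.mem_coe, Module.End.mem_eigenspace_iff] at hx
    rw [hx]
    exact (N p).smul_mem _ (Module.End.mem_eigenspace_iff.2 hx)
  rw [LinearMap.trace_eq_sum_trace_restrict' hint hfin hmaps]
  have htr : ∀ p, LinearMap.trace K (N p) (f.restrict (hmaps p)) =
      (((p : ℤ) * Module.finrank K (N p) : ℤ) : K) := fun p ↦ by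
    have : f.restrict (hmaps p) = ((p : ℤ) : K) • LinearMap.id := by
      ext x
      exact Module.End.mem_eigenspace_iff.1 x.2
    rw [this]
    simp
  simp_rw [htr]
  rw [← Int.cast_sum, Int.cast_ne_zero]
  refine (Finset.sum_neg (fun p hp ↦ ?_) ?_).ne
  · have : 0 < Module.finrank K (N p) := Module.finrank_pos_iff.2
      ((Submodule.nontrivial_iff_ne_bot).2 (by simpa using hp))
    exact mul_neg_of_neg_of_pos p.2 (by exact_mod_cast this)
  · by_contra hne
    rw [Finset.not_nonempty_iff_eq_empty, Set.Finite.toFinset_eq_empty] at hne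
    have : ∀ p, N p = ⊥ := fun p ↦ by
      by_contra hp
      exact (hne ▸ hp : p ∈ (∅ : Set _))
    rw [iSup_congr this, iSup_bot] at h
    exact bot_ne_top h

/-- The Killing form is invariant under derivations. -/
lemma killingForm_derivation_apply (D : LieDerivation K L L) (x y : L) :
    killingForm K L (D x) y = - killingForm K L x (D y) := by
  have h : ∀ z, LieAlgebra.ad K L (D z) = (D : L →ₗ[K] L) * LieAlgebra.ad K L z -
      LieAlgebra.ad K L z * (D : L →ₗ[K] L) := fun z ↦ by
    ext w
    simp [D.apply_lie_eq_add]
  have h' : ∀ A B C : Module.End K L, LinearMap.trace K L ((A * B - B * A) * C) =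
      - LinearMap.trace K L (B * (A * C - C * A)) := fun A B C ↦ by
    rw [← map_neg, ← sub_eq_zero, ← map_sub]
    have : (A * B - B * A) * C - -(B * (A * C - C * A)) = A * (B * C) - (B * C) * A := by
      noncomm_ring
    rw [this, map_sub, LinearMap.trace_mul_comm, sub_self]
  rw [LieModule.traceForm_apply_apply, LieModule.traceForm_apply_apply]
  exact (by rw [h x, h y]; exact h' _ _ _ :
    LinearMap.trace K L (LieAlgebra.ad K L (D x) * LieAlgebra.ad K L y) =
      - LinearMap.trace K L (LieAlgebra.ad K L x * LieAlgebra.ad K L (D y)))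

lemma derivation_mem_killingCompl_top (D : LieDerivation K L L) {x : L}
    (hx : x ∈ LieIdeal.killingCompl K L ⊤) : D x ∈ LieIdeal.killingCompl K L ⊤ := by
  rw [LieIdeal.mem_killingCompl] at hx ⊢
  intro y _
  rw [← neg_neg (killingForm K L y (D x)), ← killingForm_derivation_apply, hx _ trivial, neg_zero]

/-- The derivation of `L ⧸ I` induced by a derivation of `L` preserving the ideal `I`. -/
def quotientDerivation (D : LieDerivation K L L) (I : LieIdeal K L) (h : ∀ x ∈ I, D x ∈ I) :
    LieDerivation K (L ⧸ I) (L ⧸ I) where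
  toLinearMap := I.toSubmodule.mapQ I.toSubmodule (D : L →ₗ[K] L) h
  leibniz' x y := by
    induction x using Submodule.Quotient.induction_on with | _ x
    induction y using Submodule.Quotient.induction_on with | _ y
    exact congrArg (LieSubmodule.Quotient.mk (N := I)) (D.leibniz' x y)

lemma map_derivedSeriesOfIdeal {L' : Type*} [LieRing L'] [LieAlgebra K L'] (f : L →ₗ⁅K⁆ L')
    (hf : Function.Surjective f) (I : LieIdeal K L) (n : ℕ) :
    (LieAlgebra.derivedSeriesOfIdeal K L n I).map f =
      LieAlgebra.derivedSeriesOfIdeal K L' n (I.map f) := by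
  induction n with
  | zero => simp
  | succ n ih => simp only [LieAlgebra.derivedSeriesOfIdeal_succ, LieIdeal.map_bracket_eq f hf, ih]

/-- The quotient map by an ideal. -/
def quotientMk (I : LieIdeal K L) : L →ₗ⁅K⁆ L ⧸ I where
  toLinearMap := I.toSubmodule.mkQ
  map_lie' := rfl

lemma quotientMk_surjective (I : LieIdeal K L) : Function.Surjective (quotientMk I) :=
  Submodule.mkQ_surjective _

lemma quotientMk_eq_zero {I : LieIdeal K L} {x : L} : quotientMk I x = 0 ↔ x ∈ I :=
  Submodule.Quotient.mk_eq_zero _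

/-- There is a solvable ideal `I` stable under a given derivation such that the Killing form
of `L ⧸ I` is nondegenerate. -/
lemma exists_stable_solvable_isKilling_quotient [CharZero K] [FiniteDimensional K L]
    (D : LieDerivation K L L) :
    ∃ I : LieIdeal K L, (∀ x ∈ I, D x ∈ I) ∧
      (∃ n, LieAlgebra.derivedSeriesOfIdeal K L n I = ⊥) ∧ LieAlgebra.IsKilling K (L ⧸ I) := by
  let S : Set (LieIdeal K L) := {I | (∀ x ∈ I, D x ∈ I) ∧
    ∃ n, LieAlgebra.derivedSeriesOfIdeal K L n I = ⊥}
  have hS : S.Nonempty := ⟨⊥, by simp, 0, by simp⟩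
  obtain ⟨I, ⟨hI, n, hn⟩, hmax⟩ :=
    (wellFounded_gt (α := LieIdeal K L)).has_min S hS
  refine ⟨I, hI, ⟨n, hn⟩, ⟨?_⟩⟩
  set C := LieIdeal.killingCompl K (L ⧸ I) ⊤
  set J : LieIdeal K L := C.comap (quotientMk I)
  have hIJ : I ≤ J := fun x hx ↦ by
    rw [LieIdeal.mem_comap, quotientMk_eq_zero.2 hx]
    exact zero_mem _
  have hJ : ∀ x ∈ J, D x ∈ J := fun x hx ↦ by
    rw [LieIdeal.mem_comap] at hx ⊢
    exact derivation_mem_killingCompl_top (quotientDerivation D I hI) hx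
  have hC : LieAlgebra.IsSolvable C := by
    rw [LieAlgebra.LieIdeal.solvable_iff_le_radical (R := K)]
    exact LieAlgebra.killingCompl_top_le_radical K (L ⧸ I)
  obtain ⟨m, hm⟩ := LieAlgebra.IsSolvable.solvable K C
  rw [LieIdeal.derivedSeries_eq_bot_iff] at hm
  have hmJ : LieAlgebra.derivedSeriesOfIdeal K L m J ≤ I := fun x hx ↦ by
    have h1 : quotientMk I x ∈ (LieAlgebra.derivedSeriesOfIdeal K L m J).map (quotientMk I) :=
      LieIdeal.mem_map hx
    rw [map_derivedSeriesOfIdeal _ (quotientMk_surjective I)] at h1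
    have h2 := LieAlgebra.derivedSeriesOfIdeal_mono
      (LieIdeal.map_comap_le (f := quotientMk I) (J := C)) m h1
    rw [hm] at h2
    exact quotientMk_eq_zero.1 h2
  have hJS : J ∈ S := ⟨hJ, n + m, by
    rw [LieAlgebra.derivedSeriesOfIdeal_add, eq_bot_iff, ← hn]
    exact LieAlgebra.derivedSeriesOfIdeal_mono hmJ n⟩
  have hEq : J ≤ I := by
    by_contra hne
    exact hmax J hJS (lt_of_le_not_ge hIJ hne)
  rw [eq_bot_iff]
  intro y hy
  obtain ⟨x, rfl⟩ := quotientMk_surjective I y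
  exact quotientMk_eq_zero.2 (hEq hy)

/-- A linear functional vanishing on brackets vanishes if the Killing form is nondegenerate. -/
lemma eq_zero_of_isKilling_of_apply_lie_eq_zero [FiniteDimensional K L] [LieAlgebra.IsKilling K L]
    (f : L →ₗ[K] K) (hf : ∀ x y : L, f ⁅x, y⁆ = 0) : f = 0 := by
  have hnd := LieAlgebra.IsKilling.killingForm_nondegenerate K L
  obtain ⟨a, rfl⟩ := (LinearMap.BilinForm.toDual (killingForm K L) hnd).surjective f
  simp only [LinearMap.BilinForm.toDual_def] at hf
  have ha : LieAlgebra.ad K L a = 0 := by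
    ext x
    refine hnd.1 _ fun y ↦ ?_
    rw [← hf x y]
    exact LieModule.traceForm_apply_lie_apply K L L a x y
  ext y
  rw [LinearMap.BilinForm.toDual_def, killingForm_apply_apply, ha, LinearMap.zero_comp, map_zero,
    LinearMap.zero_apply]

lemma isKilling_of_isKilling_quotient_bot (h : LieAlgebra.IsKilling K (L ⧸ (⊥ : LieIdeal K L))) :
    LieAlgebra.IsKilling K L :=
  LieAlgebra.isKilling_of_equiv (LieEquiv.ofBijective (quotientMk (⊥ : LieIdeal K L))
    ⟨(injective_iff_map_eq_zero _).2 fun x hx ↦ (LieSubmodule.mem_bot x).1 (quotientMk_eq_zero.1 hx),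
      quotientMk_surjective _⟩).symm

end General

section Graded

variable {K L : Type*} [Field K] [LieRing L] [LieAlgebra K L]
variable {𝒢 : ℤ → Submodule K L}

lemma le_negPart {p : ℤ} (hp : p < 0) : 𝒢 p ≤ negPart 𝒢 :=
  le_iSup (fun p : {p : ℤ // p < 0} ↦ 𝒢 p) ⟨p, hp⟩

lemma le_nonnegPart {p : ℤ} (hp : 0 ≤ p) : 𝒢 p ≤ nonnegPart 𝒢 :=
  le_iSup (fun p : {p : ℤ // 0 ≤ p} ↦ 𝒢 p) ⟨p, hp⟩

lemma eq_zero_of_forall_lie (heff : IsEffective 𝒢) {p : ℤ} (hp : 0 ≤ p) {x : L} (hx : x ∈ 𝒢 p)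
    (h : ∀ y ∈ 𝒢 (-1), ⁅x, y⁆ = 0) : x = 0 := heff x (le_nonnegPart hp hx) h

variable (𝒢) [GradedLieAlgebra 𝒢]

/-- The projection onto the homogeneous component of degree `p`. -/
noncomputable def proj (p : ℤ) : L →ₗ[K] L :=
  (𝒢 p).subtype ∘ₗ DirectSum.component K ℤ (fun i ↦ 𝒢 i) p ∘ₗ
    (DirectSum.decomposeLinearEquiv 𝒢).toLinearMap

lemma proj_mem (p : ℤ) (x : L) : proj 𝒢 p x ∈ 𝒢 p := (DirectSum.decompose 𝒢 x p).2

variable {𝒢}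

lemma proj_of_mem {p : ℤ} {x : L} (hx : x ∈ 𝒢 p) : proj 𝒢 p x = x :=
  DirectSum.decompose_of_mem_same 𝒢 hx

lemma proj_of_mem_ne {p q : ℤ} {x : L} (hx : x ∈ 𝒢 p) (h : p ≠ q) : proj 𝒢 q x = 0 :=
  DirectSum.decompose_of_mem_ne 𝒢 hx h

lemma lie_mem_of_eq {p q r : ℤ} {x y : L} (hx : x ∈ 𝒢 p) (hy : y ∈ 𝒢 q) (h : p + q = r) :
    ⁅x, y⁆ ∈ 𝒢 r := h ▸ SetLike.GradedBracket.bracket_mem hx hy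

variable (𝒢) in
lemma graded_induction {motive : L → Prop} (hom : ∀ p, ∀ x ∈ 𝒢 p, motive x)
    (add : ∀ x y, motive x → motive y → motive (x + y)) (x : L) : motive x :=
  DirectSum.Decomposition.inductionOn 𝒢 (hom 0 0 (zero_mem _)) (fun x ↦ hom _ _ x.2) add x

lemma proj_lie {q : ℤ} {y : L} (hy : y ∈ 𝒢 q) (p : ℤ) (x : L) :
    proj 𝒢 (p + q) ⁅x, y⁆ = ⁅proj 𝒢 p x, y⁆ := by
  induction x using graded_induction 𝒢 with
  | hom r x hx =>
    by_cases h : r = p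
    · subst h
      rw [proj_of_mem hx, proj_of_mem (lie_mem_of_eq hx hy rfl)]
    · rw [proj_of_mem_ne hx h, proj_of_mem_ne (lie_mem_of_eq hx hy rfl) (by simpa), zero_lie]
  | add x y hx hy => rw [add_lie, map_add, map_add, add_lie, hx, hy]

variable (𝒢) in
lemma exists_eq_sum_proj (x : L) : ∃ s : Finset ℤ, x = ∑ p ∈ s, proj 𝒢 p x := by
  classical
  exact ⟨_, (DirectSum.sum_support_decompose 𝒢 x).symm⟩

variable (𝒢) in
lemma mem_of_forall_proj_mem {W : Submodule K L} {x : L} (h : ∀ p, proj 𝒢 p x ∈ W) : x ∈ W := by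
  obtain ⟨s, hs⟩ := exists_eq_sum_proj 𝒢 x
  rw [hs]
  exact sum_mem fun p _ ↦ h p

variable (𝒢) in
/-- The endomorphism acting on `𝔤_p` as multiplication by `p`. -/
noncomputable def degreeEnd : L →ₗ[K] L :=
  DirectSum.toModule K ℤ L (fun p ↦ (p : K) • (𝒢 p).subtype) ∘ₗ
    (DirectSum.decomposeLinearEquiv 𝒢).toLinearMap

lemma degreeEnd_of_mem {p : ℤ} {x : L} (hx : x ∈ 𝒢 p) : degreeEnd 𝒢 x = (p : K) • x := by
  rw [degreeEnd, LinearMap.comp_apply, LinearEquiv.coe_coe, DirectSum.decomposeLinearEquiv_apply,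
    DirectSum.decompose_of_mem 𝒢 hx, ← DirectSum.lof_eq_of K, DirectSum.toModule_lof]
  rfl

variable (𝒢) in
/-- The degree derivation, acting on `𝔤_p` as multiplication by `p`. -/
noncomputable def degreeDerivation : LieDerivation K L L where
  toLinearMap := degreeEnd 𝒢
  leibniz' x y := by
    induction x using graded_induction 𝒢 with
    | hom p x hx =>
      induction y using graded_induction 𝒢 with
      | hom q y hy =>
        rw [degreeEnd_of_mem hx, degreeEnd_of_mem hy, degreeEnd_of_mem (lie_mem_of_eq hx hy rfl),
          lie_smul, lie_smul, ← lie_skew x y]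
        push_cast
        module
      | add y z hy hz => rw [lie_add, map_add, hy, hz, map_add, lie_add, add_lie]; abel
    | add x z hx hz => rw [add_lie, map_add, hx, hz, map_add, lie_add, add_lie]; abel

lemma degreeDerivation_of_mem {p : ℤ} {x : L} (hx : x ∈ 𝒢 p) :
    degreeDerivation 𝒢 x = (p : K) • x := degreeEnd_of_mem hx

/-- A subspace stable under the degree derivation contains the homogeneous components of its
elements. -/
lemma proj_mem_of_stable [CharZero K] {W : Submodule K L} (hW : ∀ x ∈ W, degreeDerivation 𝒢 x ∈ W)
    {x : L} (hx : x ∈ W) (p : ℤ) : proj 𝒢 p x ∈ W := by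
  have key : ∀ (s : Finset ℤ) (f : ℤ → L), (∀ p, f p ∈ 𝒢 p) → ∑ p ∈ s, f p ∈ W →
      ∀ p ∈ s, f p ∈ W := by
    intro s
    induction s using Finset.induction_on with
    | empty => simp
    | insert a s ha ih =>
      intro f hf hs
      have h1 : ∑ p ∈ s, ((p : K) - a) • f p ∈ W := by
        have h2 := sub_mem (hW _ hs) (W.smul_mem (a : K) hs)
        have h3 : ∀ p, degreeDerivation 𝒢 (f p) = (p : K) • f p :=
          fun p ↦ degreeDerivation_of_mem (hf p)
        rw [Finset.sum_insert ha, map_add, map_sum, smul_add, Finset.smul_sum, h3,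
          add_sub_add_left_eq_sub, ← Finset.sum_sub_distrib] at h2
        simpa only [h3, sub_smul] using h2
      have h4 : ∀ p ∈ s, f p ∈ W := fun p hp ↦ by
        have h5 := ih (fun p ↦ ((p : K) - a) • f p) (fun p ↦ (𝒢 p).smul_mem _ (hf p)) h1 p hp
        refine (W.smul_mem_iff ?_).1 h5
        rw [sub_ne_zero, Ne, Int.cast_inj]
        rintro rfl
        exact ha hp
      intro p hp
      rcases Finset.mem_insert.1 hp with rfl | hp
      · rw [Finset.sum_insert ha] at hs
        exact (W.add_mem_iff_left (sum_mem h4)).1 hs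
      · exact h4 p hp
  obtain ⟨s, hs⟩ := exists_eq_sum_proj 𝒢 x
  by_cases hp : p ∈ s
  · exact key s (fun p ↦ proj 𝒢 p x) (fun p ↦ proj_mem 𝒢 p x) (hs ▸ hx) p hp
  · have : proj 𝒢 p x = 0 := by
      rw [hs, map_sum]
      refine Finset.sum_eq_zero fun q hq ↦ proj_of_mem_ne (proj_mem 𝒢 q x) ?_
      rintro rfl
      exact hp hq
    rw [this]
    exact zero_mem _

lemma proj_of_mem_negPart {x : L} (hx : x ∈ negPart 𝒢) {p : ℤ} (hp : 0 ≤ p) : proj 𝒢 p x = 0 := by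
  suffices negPart 𝒢 ≤ LinearMap.ker (proj 𝒢 p) from this hx
  exact iSup_le fun q y hy ↦ proj_of_mem_ne hy (by have := q.2; omega)

lemma mem_negPart_of_forall_proj {x : L} (h : ∀ p, 0 ≤ p → proj 𝒢 p x = 0) : x ∈ negPart 𝒢 := by
  refine mem_of_forall_proj_mem 𝒢 fun p ↦ ?_
  rcases lt_or_ge p 0 with hp | hp
  · exact le_negPart hp (proj_mem 𝒢 p x)
  · rw [h p hp]
    exact zero_mem _

/-- A subspace of `𝔤₋₁` stable under the irreducible action of `𝔤₀` is zero or `𝔤₋₁`. -/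
lemma disjoint_or_le_of_irreducible (hirr : IsIrreducibleRep 𝒢 (-1)) (W : Submodule K L)
    (hW : ∀ x ∈ 𝒢 0, ∀ y ∈ W, y ∈ 𝒢 (-1) → ⁅x, y⁆ ∈ W) :
    (∀ y ∈ 𝒢 (-1), y ∈ W → y = 0) ∨ 𝒢 (-1) ≤ W := by
  let N : LieSubmodule K (structureSubalgebra 𝒢) (𝒢 (-1)) :=
    { W.comap (𝒢 (-1)).subtype with
      lie_mem := fun {x m} hm ↦ hW x x.2 m hm m.2 }
  have hN : ∀ y, y ∈ N ↔ (y : L) ∈ W := fun _ ↦ Iff.rfl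
  have : IsSimpleOrder (LieSubmodule K (structureSubalgebra 𝒢) (𝒢 (-1))) := hirr
  rcases eq_bot_or_eq_top N with h | h
  · left
    intro y hy hyW
    have : (⟨y, hy⟩ : 𝒢 (-1)) ∈ N := hyW
    rw [h, LieSubmodule.mem_bot] at this
    exact congrArg Subtype.val this
  · right
    intro y hy
    have : (⟨y, hy⟩ : 𝒢 (-1)) ∈ N := h ▸ LieSubmodule.mem_top _
    exact this

lemma exists_ne_zero_of_irreducible (hirr : IsIrreducibleRep 𝒢 (-1)) : ∃ y ∈ 𝒢 (-1), y ≠ 0 := by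
  have : IsSimpleOrder (LieSubmodule K (structureSubalgebra 𝒢) (𝒢 (-1))) := hirr
  have : Nontrivial (𝒢 (-1)) :=
    (LieSubmodule.nontrivial_iff K (structureSubalgebra 𝒢) _).1 inferInstance
  obtain ⟨y, hy⟩ := exists_ne (0 : 𝒢 (-1))
  exact ⟨y, y.2, by simpa using hy⟩

/-- An ideal meeting `𝔤₋₁` trivially has no nonzero homogeneous elements of degree at
least `-1`. -/
lemma eq_zero_of_mem_of_forall_mem (heff : IsEffective 𝒢) {I : LieIdeal K L}
    (hI : ∀ y ∈ 𝒢 (-1), y ∈ I → y = 0) {p : ℤ} (hp : -1 ≤ p) {x : L} (hx : x ∈ 𝒢 p)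
    (hxI : x ∈ I) : x = 0 := by
  induction p, hp using Int.leInduction generalizing x with
  | base => exact hI x hx hxI
  | succ p hp ih =>
    exact eq_zero_of_forall_lie heff (by omega) hx fun y hy ↦
      ih (lie_mem_of_eq hx hy (by ring)) (lie_mem_left K L I x y hxI)

end Graded

section Structure

variable {K L : Type*} [Field K] [LieRing L] [LieAlgebra K L]
variable {𝒢 : ℤ → Submodule K L} [GradedLieAlgebra 𝒢]

/-- If `I` is a nonzero graded ideal meeting `𝔤₋₁` trivially, then the Killing form of `𝔤 ⧸ I` is
degenerate. -/
theorem not_isKilling_quotient [CharZero K] [FiniteDimensional K L] (heff : IsEffective 𝒢)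
    (hfund : IsFundamental 𝒢) {I : LieIdeal K L} (hD : ∀ x ∈ I, degreeDerivation 𝒢 x ∈ I)
    (hI : ∀ y ∈ 𝒢 (-1), y ∈ I → y = 0) (hne : I ≠ ⊥) : ¬ LieAlgebra.IsKilling K (L ⧸ I) := by
  intro hK
  set D := degreeDerivation 𝒢 with hDdef
  have hproj : ∀ p, -1 ≤ p → ∀ x ∈ I, proj 𝒢 p x = 0 := fun p hp x hx ↦
    eq_zero_of_mem_of_forall_mem heff hI hp (proj_mem 𝒢 p x)
      (proj_mem_of_stable (W := I.toSubmodule) hD hx p)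
  let φ : L →ₗ[K] K := LinearMap.trace K I ∘ₗ (LieModule.toEnd K L I : L →ₗ[K] Module.End K I)
  have hφ : ∀ x, φ x = LinearMap.trace K I (LieModule.toEnd K L I x) := fun _ ↦ rfl
  let DI : Module.End K I := (D : L →ₗ[K] L).restrict (p := I.toSubmodule) (q := I.toSubmodule) hD
  have hφlie : ∀ x y, φ ⁅x, y⁆ = 0 := fun x y ↦ by
    have : LieModule.toEnd K L I ⁅x, y⁆ = LieModule.toEnd K L I x * LieModule.toEnd K L I y -
        LieModule.toEnd K L I y * LieModule.toEnd K L I x := by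
      ext z : 1
      exact lie_lie x y z
    rw [hφ, this, map_sub, LinearMap.trace_mul_comm, sub_self]
  have hφD : ∀ x, φ (D x) = 0 := fun x ↦ by
    have : LieModule.toEnd K L I (D x) =
        DI * LieModule.toEnd K L I x - LieModule.toEnd K L I x * DI := by
      ext z
      change ⁅D x, (z : L)⁆ = D ⁅x, (z : L)⁆ - ⁅x, D z⁆
      rw [D.apply_lie_eq_add]
      abel
    rw [hφ, this, map_sub, LinearMap.trace_mul_comm, sub_self]
  have hφ0 : ∀ x, φ x = φ (proj 𝒢 0 x) := fun x ↦ by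
    induction x using graded_induction 𝒢 with
    | hom p x hx =>
      by_cases hp : p = 0
      · subst hp
        rw [proj_of_mem hx]
      · rw [proj_of_mem_ne hx hp, map_zero]
        have h1 := hφD x
        rw [hDdef, degreeDerivation_of_mem hx, map_smul, smul_eq_mul] at h1
        exact (mul_eq_zero.1 h1).resolve_left (Int.cast_ne_zero.2 hp)
    | add x y hx hy => rw [map_add, map_add, map_add, hx, hy]
  have hφI : I.toSubmodule ≤ LinearMap.ker φ := fun x hx ↦ by
    rw [LinearMap.mem_ker, hφ0, hproj 0 (by norm_num) x hx, map_zero]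
  have hφzero : ∀ x, φ x = 0 := fun x ↦ by
    have h1 := eq_zero_of_isKilling_of_apply_lie_eq_zero (L := L ⧸ I) (I.toSubmodule.liftQ φ hφI)
      fun x y ↦ by
        obtain ⟨x, rfl⟩ := quotientMk_surjective I x
        obtain ⟨y, rfl⟩ := quotientMk_surjective I y
        rw [← LieHom.map_lie]
        exact hφlie x y
    exact LinearMap.congr_fun h1 (quotientMk I x)
  obtain ⟨e', he'⟩ := LieDerivation.IsKilling.exists_eq_ad (quotientDerivation D I hD)
  obtain ⟨e, rfl⟩ := quotientMk_surjective I e'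
  have he : ∀ x, ⁅e, x⁆ - D x ∈ I := fun x ↦ by
    have h1 : ⁅quotientMk I e, quotientMk I x⁆ = quotientMk I (D x) :=
      (by simpa using LieDerivation.congr_fun he' (quotientMk I x) :
        ⁅quotientMk I e, quotientMk I x⁆ = quotientDerivation D I hD (quotientMk I x))
    rw [← quotientMk_eq_zero, map_sub, LieHom.map_lie, h1, sub_self]
  have hneg : ∀ y ∈ 𝒢 (-1), ⁅proj 𝒢 0 e, y⁆ = D y := fun y hy ↦ by
    have h1 := hproj (-1) le_rfl _ (he y)
    have h2 := proj_lie hy 0 e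
    rw [zero_add] at h2
    rw [map_sub, h2, hDdef, degreeDerivation_of_mem hy, map_smul, proj_of_mem hy] at h1
    rw [hDdef, degreeDerivation_of_mem hy]
    exact sub_eq_zero.1 h1
  have hm : ∀ x ∈ negPart 𝒢, ⁅proj 𝒢 0 e, x⁆ = D x := fun x hx ↦ by
    rw [← hfund] at hx
    simpa using LieDerivation.eqOn_lieSpan (D1 := LieDerivation.ad K L (proj 𝒢 0 e)) (D2 := D)
      (fun y hy ↦ by simpa using hneg y hy) hx
  have hDI : LieModule.toEnd K L I (proj 𝒢 0 e) = DI := by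
    ext z
    exact hm z (mem_negPart_of_forall_proj fun p hp ↦ hproj p (by omega) z z.2)
  have : Nontrivial I := (LieSubmodule.nontrivial_iff_ne_bot K L L).2 hne
  refine trace_ne_zero_of_iSup_eigenspace_eq_top DI (eq_top_iff.2 fun z _ ↦ ?_)
    (by rw [← hDI, ← hφ, hφzero])
  obtain ⟨s, hs⟩ := exists_eq_sum_proj 𝒢 (z : L)
  have hz : z = ∑ p ∈ s, ⟨proj 𝒢 p z, proj_mem_of_stable (W := I.toSubmodule) hD z.2 p⟩ :=
    Subtype.ext (by simpa using hs)
  rw [hz]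
  refine sum_mem fun p _ ↦ ?_
  rcases lt_or_ge p 0 with hp | hp
  · refine le_iSup (fun p : {p : ℤ // p < 0} ↦ DI.eigenspace ((p : ℤ) : K)) ⟨p, hp⟩ ?_
    rw [Module.End.mem_eigenspace_iff]
    exact Subtype.ext (degreeDerivation_of_mem (proj_mem 𝒢 p z))
  · have h0 : (⟨proj 𝒢 p z, proj_mem_of_stable (W := I.toSubmodule) hD z.2 p⟩ : I) = 0 :=
      Subtype.ext (hproj p (by omega) z z.2)
    rw [h0]
    exact Submodule.zero_mem _

/-- If a solvable ideal contains `𝔤₋₁`, then there are no elements of positive degree. -/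
theorem eq_bot_of_solvable_of_le (heff : IsEffective 𝒢)
    (hirr : IsIrreducibleRep 𝒢 (-1)) {I : LieIdeal K L}
    (hle : 𝒢 (-1) ≤ I.toSubmodule)
    (hsol : ∃ n, LieAlgebra.derivedSeriesOfIdeal K L n I = ⊥) {p : ℤ} (hp : 0 < p) : 𝒢 p = ⊥ := by
  classical
  have hex : ∃ n, ¬ 𝒢 (-1) ≤ (LieAlgebra.derivedSeriesOfIdeal K L n I).toSubmodule := by
    obtain ⟨n, hn⟩ := hsol
    obtain ⟨y, hy, hy0⟩ := exists_ne_zero_of_irreducible hirr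
    refine ⟨n, fun h ↦ hy0 ?_⟩
    have := h hy
    rwa [hn] at this
  obtain ⟨n, hn⟩ : ∃ n, Nat.find hex = n + 1 :=
    Nat.exists_eq_succ_of_ne_zero fun h ↦ (Nat.find_spec hex) (by rw [h]; exact hle)
  set B := LieAlgebra.derivedSeriesOfIdeal K L n I
  have hB : 𝒢 (-1) ≤ B.toSubmodule := not_not.1 (Nat.find_min hex (by omega))
  have hBB : ∀ y ∈ 𝒢 (-1), y ∈ ⁅B, B⁆ → y = 0 := by
    have h1 := Nat.find_spec hex
    rw [hn, LieAlgebra.derivedSeriesOfIdeal_succ] at h1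
    exact (disjoint_or_le_of_irreducible hirr (⁅B, B⁆ : LieIdeal K L).toSubmodule
      fun x _ y hy _ ↦ LieSubmodule.lie_mem _ hy).resolve_right h1
  have hBp : ∀ p, 0 ≤ p → ∀ x ∈ 𝒢 p, x ∈ B → x = 0 := by
    intro p hp
    induction p, hp using Int.leInduction with
    | base =>
      exact fun x hx hxB ↦ eq_zero_of_forall_lie heff le_rfl hx fun y hy ↦
        hBB _ (lie_mem_of_eq hx hy (by ring)) (LieSubmodule.lie_mem_lie hxB (hB hy))
    | succ p hp ih =>
      exact fun x hx hxB ↦ eq_zero_of_forall_lie heff (by omega) hx fun y hy ↦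
        ih _ (lie_mem_of_eq hx hy (by ring)) (lie_mem_left K L B x y hxB)
  refine (Submodule.eq_bot_iff _).2 fun x hx ↦ eq_zero_of_forall_lie heff hp.le hx fun y hy ↦ ?_
  exact hBp (p - 1) (by omega) _ (lie_mem_of_eq hx hy (by ring)) (B.lie_mem (hB hy))

end Structure

section Nilradical

variable {K L : Type*} [Field K] [LieRing L] [LieAlgebra K L]
variable (𝒢 : ℤ → Submodule K L) [GradedLieAlgebra 𝒢]

/-- The elements all of whose homogeneous components have degree at most `n`. -/
noncomputable def degreeLE (n : ℤ) : Submodule K L := ⨅ p : {p : ℤ // n < p}, LinearMap.ker (proj 𝒢 p)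

variable {𝒢}

lemma mem_degreeLE {n : ℤ} {x : L} : x ∈ degreeLE 𝒢 n ↔ ∀ p, n < p → proj 𝒢 p x = 0 := by
  simp [degreeLE]

lemma mem_degreeLE_of_mem {p n : ℤ} (h : p ≤ n) {x : L} (hx : x ∈ 𝒢 p) : x ∈ degreeLE 𝒢 n :=
  mem_degreeLE.2 fun _ hq ↦ proj_of_mem_ne hx (by omega)

lemma lie_mem_degreeLE {m n k : ℤ} (h : m + n = k) {x y : L} (hx : x ∈ degreeLE 𝒢 m)
    (hy : y ∈ degreeLE 𝒢 n) : ⁅x, y⁆ ∈ degreeLE 𝒢 k := by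
  rw [mem_degreeLE] at *
  intro p hp
  obtain ⟨s, hs⟩ := exists_eq_sum_proj 𝒢 y
  rw [hs, lie_sum, map_sum]
  refine Finset.sum_eq_zero fun q _ ↦ ?_
  have h1 := proj_lie (proj_mem 𝒢 q y) (p - q) x
  rw [sub_add_cancel] at h1
  rw [h1]
  rcases lt_or_ge n q with hq | hq
  · rw [hy q hq, lie_zero]
  · rw [hx (p - q) (by omega), zero_lie]

lemma degreeLE_neg_one : degreeLE 𝒢 (-1) = negPart 𝒢 := by
  ext x
  rw [mem_degreeLE]
  exact ⟨fun h ↦ mem_negPart_of_forall_proj fun p hp ↦ h p (by omega),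
    fun h p hp ↦ proj_of_mem_negPart h (by omega)⟩

lemma mem_degreeLE_zero (hpos : ∀ p, 0 < p → 𝒢 p = ⊥) (x : L) : x ∈ degreeLE 𝒢 0 :=
  mem_degreeLE.2 fun p hp ↦ by simpa [hpos p hp] using proj_mem 𝒢 p x

/-- The negative part of a graded Lie algebra without elements of positive degree, as an ideal. -/
def negIdeal (hpos : ∀ p, 0 < p → 𝒢 p = ⊥) : LieIdeal K L where
  toSubmodule := negPart 𝒢
  lie_mem {x y} hy := by
    change y ∈ negPart 𝒢 at hy
    change ⁅x, y⁆ ∈ negPart 𝒢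
    rw [← degreeLE_neg_one] at *
    exact lie_mem_degreeLE (by norm_num) (mem_degreeLE_zero hpos x) hy

variable (𝒢) in
lemma exists_degreeLE_eq_bot [FiniteDimensional K L] : ∃ N : ℕ, degreeLE 𝒢 (-N) = ⊥ := by
  have hfin : {p | 𝒢 p ≠ ⊥}.Finite := WellFoundedGT.finite_ne_bot_of_iSupIndep
    (DirectSum.Decomposition.isInternal 𝒢).submodule_iSupIndep
  obtain ⟨b, hb⟩ := hfin.bddBelow
  refine ⟨(b.natAbs + 1), (Submodule.eq_bot_iff _).2 fun x hx ↦ ?_⟩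
  rw [mem_degreeLE] at hx
  refine (Submodule.mem_bot K).1 (mem_of_forall_proj_mem 𝒢 fun p ↦ (Submodule.mem_bot K).2 ?_)
  by_cases hp : 𝒢 p = ⊥
  · simpa [hp] using proj_mem 𝒢 p x
  · have := hb hp
    exact hx p (by omega)

lemma isNilpotent_negIdeal [FiniteDimensional K L] (hpos : ∀ p, 0 < p → 𝒢 p = ⊥) :
    LieRing.IsNilpotent (negIdeal hpos) := by
  have key : ∀ (n : ℕ) (x : negIdeal hpos),
      x ∈ LieModule.lowerCentralSeries K (negIdeal hpos) (negIdeal hpos) n →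
        (x : L) ∈ degreeLE 𝒢 (-n) := by
    intro n
    induction n with
    | zero => exact fun x _ ↦ by simpa using mem_degreeLE_zero hpos x
    | succ n ih =>
      let N : LieSubmodule K (negIdeal hpos) (negIdeal hpos) :=
        { (degreeLE 𝒢 (-(n + 1 : ℕ))).comap (negIdeal hpos).toSubmodule.subtype with
          lie_mem := fun {x y} hy ↦
            lie_mem_degreeLE (zero_add _) (mem_degreeLE_zero hpos x) hy }
      have hN : LieModule.lowerCentralSeries K (negIdeal hpos) (negIdeal hpos) (n + 1) ≤ N := by
        rw [LieModule.lowerCentralSeries_succ, LieSubmodule.lie_le_iff]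
        intro x _ y hy
        exact lie_mem_degreeLE (m := -1) (by push_cast; ring)
          (by rw [degreeLE_neg_one]; exact x.2) (ih y hy)
      exact fun x hx ↦ hN hx
  obtain ⟨N, hN⟩ := exists_degreeLE_eq_bot 𝒢
  refine (LieModule.isNilpotent_iff K _ _).2 ⟨N, (LieSubmodule.eq_bot_iff _).2 fun x hx ↦ ?_⟩
  have := key N x hx
  rw [hN, Submodule.mem_bot] at this
  exact Subtype.ext this

lemma le_negIdeal_of_isNilpotent (heff : IsEffective 𝒢) (hirr : IsIrreducibleRep 𝒢 (-1))
    (hpos : ∀ p, 0 < p → 𝒢 p = ⊥) (I : LieIdeal K L) [hI : LieRing.IsNilpotent I] :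
    I ≤ negIdeal hpos := by
  let W : Submodule K L :=
    Submodule.span K {z | ∃ x ∈ I, ∃ y ∈ 𝒢 (-1), ⁅proj 𝒢 0 x, y⁆ = z}
  have hWmem : ∀ x ∈ I, ∀ y ∈ 𝒢 (-1), ⁅proj 𝒢 0 x, y⁆ ∈ W := fun x hx y hy ↦
    Submodule.subset_span ⟨x, hx, y, hy, rfl⟩
  have hW : ∀ z ∈ 𝒢 0, ∀ w ∈ W, ⁅z, w⁆ ∈ W := by
    intro z hz w hw
    induction hw using Submodule.span_induction with
    | mem w hw =>
      obtain ⟨x, hx, y, hy, rfl⟩ := hw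
      have h1 := proj_lie hz 0 x
      rw [zero_add] at h1
      rw [leibniz_lie, ← lie_skew z, ← h1, ← map_neg, lie_skew]
      exact add_mem (hWmem _ (I.lie_mem hx) y hy)
        (hWmem x hx _ (lie_mem_of_eq hz hy (by norm_num)))
    | zero => simp
    | add x y _ _ hx hy => rw [lie_add]; exact add_mem hx hy
    | smul c x _ hx => rw [lie_smul]; exact W.smul_mem c hx
  rcases disjoint_or_le_of_irreducible hirr W (fun x hx y hy _ ↦ hW x hx y hy) with h | h
  · intro x hx
    refine mem_negPart_of_forall_proj fun p hp ↦ ?_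
    rcases hp.lt_or_eq with hp | rfl
    · simpa [hpos p hp] using proj_mem 𝒢 p x
    · exact eq_zero_of_forall_lie heff le_rfl (proj_mem 𝒢 0 x) fun y hy ↦
        h _ (lie_mem_of_eq (proj_mem 𝒢 0 x) hy (by norm_num)) (hWmem x hx y hy)
  · exfalso
    let T : ℕ → Submodule K L := fun n ↦
      (LieModule.lowerCentralSeries K I I n).toSubmodule.map I.toSubmodule.subtype ⊓ degreeLE 𝒢 (-1)
    have hlie : ∀ x, ∀ t ∈ degreeLE 𝒢 (-1), ⁅x, t⁆ ∈ degreeLE 𝒢 (-1) ∧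
        proj 𝒢 (-1) ⁅x, t⁆ = ⁅proj 𝒢 0 x, proj 𝒢 (-1) t⁆ := by
      intro x t ht
      have hx := mem_degreeLE_zero hpos x
      refine ⟨lie_mem_degreeLE (by norm_num) hx ht, ?_⟩
      have h1 : t - proj 𝒢 (-1) t ∈ degreeLE 𝒢 (-2) := mem_degreeLE.2 fun p hp ↦ by
        by_cases hp1 : p = -1
        · subst hp1
          rw [map_sub, proj_of_mem (proj_mem 𝒢 (-1) t), sub_self]
        · rw [map_sub, proj_of_mem_ne (proj_mem 𝒢 (-1) t) (Ne.symm hp1),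
            mem_degreeLE.1 ht p (by omega), sub_self]
      have h2 := mem_degreeLE.1 (lie_mem_degreeLE (zero_add _) hx h1) (-1) (by norm_num)
      have h3 := proj_lie (proj_mem 𝒢 (-1) t) 0 x
      rw [zero_add] at h3
      rwa [lie_sub, map_sub, h3, sub_eq_zero] at h2
    have hT : ∀ n, 𝒢 (-1) ≤ (T n).map (proj 𝒢 (-1)) := by
      intro n
      induction n with
      | zero =>
        refine h.trans (Submodule.span_le.2 ?_)
        rintro _ ⟨x, hx, y, hy, rfl⟩
        have h1 := hlie x y (mem_degreeLE_of_mem le_rfl hy)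
        rw [proj_of_mem hy] at h1
        exact ⟨⁅x, y⁆, ⟨⟨⟨_, lie_mem_left K L I x y hx⟩, by simp, rfl⟩, h1.1⟩, h1.2⟩
      | succ n ih =>
        refine h.trans (Submodule.span_le.2 ?_)
        rintro _ ⟨x, hx, y, hy, rfl⟩
        obtain ⟨_, ⟨⟨t, htn, rfl⟩, ht⟩, rfl⟩ := ih hy
        refine ⟨⁅x, (t : L)⁆, ⟨⟨⁅(⟨x, hx⟩ : I), t⁆, ?_, rfl⟩, (hlie x t ht).1⟩, (hlie x t ht).2⟩
        rw [SetLike.mem_coe, LieSubmodule.mem_toSubmodule, LieModule.lowerCentralSeries_succ]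
        exact LieSubmodule.lie_mem_lie (LieSubmodule.mem_top _) htn
    obtain ⟨n, hn⟩ := LieModule.IsNilpotent.nilpotent K I I
    obtain ⟨y, hy, hy0⟩ := exists_ne_zero_of_irreducible hirr
    obtain ⟨_, ⟨⟨t, htn, rfl⟩, -⟩, rfl⟩ := hT n hy
    rw [hn, SetLike.mem_coe, LieSubmodule.mem_toSubmodule, LieSubmodule.mem_bot] at htn
    rw [htn, map_zero, map_zero] at hy0
    exact hy0 rfl

theorem nilradical_eq_negPart [FiniteDimensional K L] (heff : IsEffective 𝒢)
    (hirr : IsIrreducibleRep 𝒢 (-1)) (hpos : ∀ p, 0 < p → 𝒢 p = ⊥) :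
    (nilradical K L).toSubmodule = negPart 𝒢 := by
  have h : nilradical K L = negIdeal hpos :=
    le_antisymm (sSup_le fun I hI ↦
        have : LieRing.IsNilpotent I := hI
        le_negIdeal_of_isNilpotent heff hirr hpos I)
      (le_sSup (isNilpotent_negIdeal hpos))
  rw [h]
  rfl

lemma isCompl_negPart (hpos : ∀ p, 0 < p → 𝒢 p = ⊥) :
    IsCompl (negPart 𝒢) (structureSubalgebra 𝒢).toSubmodule := by
  rw [isCompl_iff, Submodule.disjoint_def, codisjoint_iff_le_sup]
  constructor
  · intro x hx hx0
    rw [← proj_of_mem (𝒢 := 𝒢) hx0, proj_of_mem_negPart hx le_rfl]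
  · refine fun x _ ↦ mem_of_forall_proj_mem 𝒢 fun p ↦ ?_
    rcases lt_trichotomy p 0 with hp | rfl | hp
    · exact Submodule.mem_sup_left (le_negPart hp (proj_mem 𝒢 p x))
    · exact Submodule.mem_sup_right (proj_mem 𝒢 0 x)
    · rw [show proj 𝒢 p x = 0 by simpa [hpos p hp] using proj_mem 𝒢 p x]
      exact zero_mem _

end Nilradical

end ZGradedLie

theorem mainTheorem7 {K : Type*} {L : Type*} [Field K] [CharZero K] [LieRing L] [LieAlgebra K L]
    [FiniteDimensional K L] (𝒢 : ℤ → Submodule K L) [GradedLieAlgebra 𝒢]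
    (heff : ZGradedLie.IsEffective 𝒢) (hfund : ZGradedLie.IsFundamental 𝒢)
    (hirr : ZGradedLie.IsIrreducibleRep 𝒢 (-1)) :
    LieAlgebra.IsSemisimple K L ∨
      ((ZGradedLie.nilradical K L).toSubmodule = ZGradedLie.negPart 𝒢 ∧
        IsCompl (ZGradedLie.negPart 𝒢) (ZGradedLie.structureSubalgebra 𝒢).toSubmodule) := by
  obtain ⟨I, hD, hsol, hK⟩ :=
    ZGradedLie.exists_stable_solvable_isKilling_quotient (ZGradedLie.degreeDerivation 𝒢)
  rcases ZGradedLie.disjoint_or_le_of_irreducible hirr I.toSubmodule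
    fun x _ y hy _ ↦ I.lie_mem hy with h | h
  · left
    by_contra hss
    have hI : I ≠ ⊥ := by
      rintro rfl
      have := ZGradedLie.isKilling_of_isKilling_quotient_bot hK
      exact hss inferInstance
    exact ZGradedLie.not_isKilling_quotient heff hfund hD h hI hK
  · right
    have hpos : ∀ p, 0 < p → 𝒢 p = ⊥ := fun p hp ↦
      ZGradedLie.eq_bot_of_solvable_of_le heff hirr h hsol hp
    exact ⟨ZGradedLie.nilradical_eq_negPart heff hirr hpos, ZGradedLie.isCompl_negPart hpos⟩
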